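/- **Setting.** A *shuffle protocol* over a data universe $\mathcal X$ consists, for each intended number $n$ of users, of a randomizer $\Pi_R$, which maps a datum $x\in\mathcal X$ to a (random, variable-length) vector of messages in $\mathcal Y^*$, and an analyzer $\Pi_A$; both know $n$ and have access to a public random string. On a dataset $(x_1,\dots,x_m)$, each of the $m$ users runs $\Pi_R$ on her datum with independent private randomness, the shuffler $\Pi_S$ applies a uniformly random permutation to all messages sent, and an observer sees the shuffled messages (and the public random string). The honest execution on $n$ users outputs $\Pi(x_1,\dots,x_n)=\Pi_A(\Pi_S(\Pi_R(x_1),\dots,\Pi_R(x_n)))$. A randomized algorithm $M$ on datasets is $(\varepsilon,\delta)$-differentially private if $\Pr[M(\vec x)\in C]\le e^{\varepsilon}\Pr[M(\vec x')\in C]+\delta$ for all events $C$ and all $\vec x,\vec x'$ differing in at most one row. The protocol is *$(\varepsilon,\delta,1/3)$-robustly shuffle private* if, for every $n$ and every integer $m$ with $n/3\le m\le n$, the observer's view of $m$ users running the $n$-user randomizer is $(\varepsilon,\delta)$-differentially private. For $d\ge 2$ and $\alpha\in(0,1/2)$, an algorithm *solves $(d,1,\alpha)$-sparse mean estimation with sample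 complexity $n$* if, for every distribution $\mathbf P$ on $\{-1,+1\}^d$ whose mean $\vec\mu$ has at most one nonzero coordinate, given $n$ independent samples from $\mathbf P$ it outputs $\vec V\in[-1,1]^d$ with $\|\vec\mu-\vec V\|_\infty\le\alpha$ with probability at least $99/100$ (over the samples and the algorithm). **Theorem.** There are absolute constants $c_0,c_1>0$ such that the following holds for all integers $d\ge2$ and all $\alpha\in(0,1/2)$, $\varepsilon>0$, $\delta\in[0,1]$ with $$\delta\log\frac d\delta\le c_0\,\frac{\alpha^2\varepsilon^2}{d}$$ (the left side being $0$ when $\delta=0$). If $\Pi$ is an $(\varepsilon,\delta,1/3)$-robustly shuffle private protocol over $\mathcal X=\{-1,+1\}^d$ that solves $(d,1,\alpha)$-sparse mean estimation with sample complexity $n$, then $$n\ \ge\ c_1\,\frac{\sqrt d}{\alpha\varepsilon}.$$ -/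

import Mathlib

open MeasureTheory ProbabilityTheory
open scoped ENNReal Nat

universe u v

noncomputable section

namespace ShuffleModel

/-! ### Variable-length message vectors -/

/-- The disjoint-union `σ`-algebra on finite sequences over `Y`: a set of lists is measurable iff,
for every length `k`, its part of length `k` is measurable in `Y^k` (with the product `σ`-algebra). -/
instance instMeasurableSpaceList {Y : Type*} [MeasurableSpace Y] : MeasurableSpace (List Y) :=
  ⨅ k : ℕ, (inferInstance : MeasurableSpace (Fin k → Y)).map List.ofFn

theorem measurableSet_list_iff {Y : Type*} [MeasurableSpace Y] {s : Set (List Y)} :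
    MeasurableSet s ↔
      ∀ k : ℕ, MeasurableSet ((List.ofFn : (Fin k → Y) → List Y) ⁻¹' s) := by
  change MeasurableSet[⨅ k : ℕ, _] s ↔ _
  rw [MeasurableSpace.measurableSet_iInf]
  rfl

theorem measurableEmbedding_ofFn {Y : Type*} [MeasurableSpace Y] (k : ℕ) :
    MeasurableEmbedding (List.ofFn : (Fin k → Y) → List Y) where
  injective := List.ofFn_injective
  measurable := fun _ hs => measurableSet_list_iff.1 hs k
  measurableSet_image' := by
    intro t ht
    rw [measurableSet_list_iff]
    intro l
    by_cases h : l = k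
    · subst h
      rwa [Set.preimage_image_eq _ List.ofFn_injective]
    · convert MeasurableSet.empty
      ext v
      simp only [Set.mem_preimage, Set.mem_image, Set.mem_empty_iff_false, iff_false]
      rintro ⟨w, -, hw⟩
      apply h
      have := congrArg List.length hw
      simpa using this.symm

theorem measurable_of_ofFn {Y Z : Type*} [MeasurableSpace Y] [MeasurableSpace Z]
    {f : List Y → Z} (h : ∀ k : ℕ, Measurable fun v : Fin k → Y => f (List.ofFn v)) :
    Measurable f := fun _ hs => measurableSet_list_iff.2 fun k => h k hs

theorem measurable_append {Y : Type*} [MeasurableSpace Y] :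
    Measurable fun p : List Y × List Y => p.1 ++ p.2 := by
  intro s hs
  have key : (fun p : List Y × List Y => p.1 ++ p.2) ⁻¹' s =
      ⋃ k : ℕ, ⋃ l : ℕ, (Prod.map (List.ofFn : (Fin k → Y) → List Y)
        (List.ofFn : (Fin l → Y) → List Y)) ''
          {q | List.ofFn (Fin.append q.1 q.2) ∈ s} := by
    ext ⟨a, b⟩
    simp only [Set.mem_preimage, Set.mem_iUnion, Set.mem_image, Set.mem_ofPred_eq, Prod.exists,
      Prod.map_apply, Prod.mk.injEq, List.ofFn_fin_append]
    constructor
    · intro h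
      exact ⟨a.length, b.length, a.get, b.get, by simpa using h, by simp, by simp⟩
    · rintro ⟨k, l, u, w, h, rfl, rfl⟩
      exact h
  rw [key]
  refine MeasurableSet.iUnion fun k => MeasurableSet.iUnion fun l => ?_
  refine ((measurableEmbedding_ofFn k).prodMap (measurableEmbedding_ofFn l)).measurableSet_image.2 ?_
  have hm : Measurable fun q : (Fin k → Y) × (Fin l → Y) => Fin.append q.1 q.2 := by
    rw [measurable_pi_iff]
    intro i
    refine Fin.addCases (fun i => ?_) (fun i => ?_) i
    · simpa using (measurable_pi_iff.1 measurable_fst i)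
    · simpa using (measurable_pi_iff.1 measurable_snd i)
  exact ((measurableEmbedding_ofFn (k + l)).measurable.comp hm) hs

/-! ### The shuffler -/

/-- The law of a uniformly random permutation of the messages in `l`. -/
def shuffleLaw {Y : Type*} [MeasurableSpace Y] (l : List Y) : Measure (List Y) :=
  ((l.length)! : ℝ≥0∞)⁻¹ •
    ∑ σ : Equiv.Perm (Fin l.length), Measure.dirac (List.ofFn fun i => l.get (σ i))

theorem shuffleLaw_ofFn {Y : Type*} [MeasurableSpace Y] {k : ℕ} (w : Fin k → Y) :
    shuffleLaw (List.ofFn w) =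
      (k ! : ℝ≥0∞)⁻¹ • ∑ σ : Equiv.Perm (Fin k), Measure.dirac (List.ofFn fun i => w (σ i)) := by
  have aux : ∀ (l : List Y) (h : l.length = k) (_ : ∀ i, l.get (Fin.cast h.symm i) = w i),
      shuffleLaw l = (k ! : ℝ≥0∞)⁻¹ •
        ∑ σ : Equiv.Perm (Fin k), Measure.dirac (List.ofFn fun i => w (σ i)) := by
    intro l h hw
    subst h
    have : w = l.get := by
      funext i
      exact (hw i).symm
    subst this
    rfl
  exact aux _ (List.length_ofFn) (fun i => by simp)

theorem measurable_shuffleLaw {Y : Type*} [MeasurableSpace Y] :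
    Measurable (shuffleLaw : List Y → Measure (List Y)) := by
  refine measurable_of_ofFn fun k => ?_
  simp only [shuffleLaw_ofFn]
  refine Measure.measurable_of_measurable_coe _ fun s hs => ?_
  simp only [Measure.smul_apply, Measure.finsetSum_apply, smul_eq_mul]
  refine Measurable.const_mul (Finset.measurable_fun_sum _ fun σ _ => ?_) _
  refine (Measure.measurable_coe hs).comp (Measure.measurable_dirac.comp ?_)
  exact (measurableEmbedding_ofFn k).measurable.comp
    (measurable_pi_iff.2 fun i => measurable_pi_apply (σ i))

/-- The shuffler: it applies a uniformly random permutation to all messages. -/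
def shuffler (Y : Type*) [MeasurableSpace Y] : Kernel (List Y) (List Y) :=
  ⟨shuffleLaw, measurable_shuffleLaw⟩

instance {Y : Type*} [MeasurableSpace Y] : IsMarkovKernel (shuffler Y) := by
  refine ⟨fun l => ⟨?_⟩⟩
  change shuffleLaw l Set.univ = 1
  simp only [shuffleLaw, Measure.smul_apply, Measure.finsetSum_apply, measure_univ,
    Finset.sum_const, Finset.card_univ, Fintype.card_perm, Fintype.card_fin, nsmul_eq_mul, mul_one,
    smul_eq_mul]
  exact ENNReal.inv_mul_cancel (by exact_mod_cast Nat.factorial_ne_zero _) (by simp)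

/-! ### Protocols -/

/-- A protocol in the shuffle model over the (discrete) data universe `X`, with messages in `Y`,
public random string in `Ω` and outputs in `O`.  The randomizer and the analyzer know the intended
number `n` of users (their first argument) and the public random string; all their further
randomness is private and independent. -/
structure Protocol (X Y Ω O : Type*) [MeasurableSpace Y] [MeasurableSpace Ω]
    [MeasurableSpace O] where
  publicCoins : Measure Ω
  isProbabilityMeasure_publicCoins : IsProbabilityMeasure publicCoins
  randomizer : ℕ → X → Kernel Ω (List Y)
  isMarkovKernel_randomizer : ∀ n x, IsMarkovKernel (randomizer n x)
  analyzer : ℕ → Kernel (Ω × List Y) O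
  isMarkovKernel_analyzer : ∀ n, IsMarkovKernel (analyzer n)

namespace Protocol

attribute [instance] isProbabilityMeasure_publicCoins isMarkovKernel_randomizer
  isMarkovKernel_analyzer

variable {X Y Ω O : Type*} [MeasurableSpace Y] [MeasurableSpace Ω] [MeasurableSpace O]

/-- The concatenation of the messages of users holding the data `x₁, x₂, …`, each of whom runs the
`n`-user randomizer with independent private randomness (given the public random string). -/
def messages (S : Protocol X Y Ω O) (n : ℕ) : List X → Kernel Ω (List Y)
  | [] => Kernel.const Ω (Measure.dirac [])
  | x :: xs => (S.randomizer n x ×ₖ messages S n xs).map fun p => p.1 ++ p.2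

instance (S : Protocol X Y Ω O) (n : ℕ) (xs : List X) : IsMarkovKernel (S.messages n xs) := by
  induction xs with
  | nil => unfold messages; infer_instance
  | cons x xs ih => unfold messages; exact Kernel.IsMarkovKernel.map _ measurable_append

/-- What an observer of the shuffler sees when `m` users holding `x` follow the protocol intended
for `n` users: the public random string together with the shuffled messages. -/
def view (S : Protocol X Y Ω O) (n : ℕ) {m : ℕ} (x : Fin m → X) : Measure (Ω × List Y) :=
  S.publicCoins ⊗ₘ (shuffler Y ∘ₖ S.messages n (List.ofFn x))

instance (S : Protocol X Y Ω O) (n : ℕ) {m : ℕ} (x : Fin m → X) :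
    IsProbabilityMeasure (S.view n x) := by
  unfold view; infer_instance

/-- The law of the output of the honest execution on the dataset `x` of `n` users. -/
def exec (S : Protocol X Y Ω O) {n : ℕ} (x : Fin n → X) : Measure O :=
  (S.view n x).bind (S.analyzer n)

instance (S : Protocol X Y Ω O) {n : ℕ} (x : Fin n → X) : IsProbabilityMeasure (S.exec x) := by
  unfold exec; infer_instance

end Protocol

/-! ### Privacy -/

/-- `(ε, δ)`-differential privacy of a randomized algorithm on datasets of `m` rows; two datasets
are neighbors if they differ in at most one row. -/
def DifferentiallyPrivate {X R : Type*} [MeasurableSpace R] {m : ℕ}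
    (M : (Fin m → X) → Measure R) (ε δ : ℝ) : Prop :=
  ∀ x x' : Fin m → X, (∃ i : Fin m, ∀ j, j ≠ i → x j = x' j) →
    ∀ C : Set R, MeasurableSet C →
      M x C ≤ ENNReal.ofReal (Real.exp ε) * M x' C + ENNReal.ofReal δ

/-- `(ε, δ, γ)`-robust shuffle differential privacy: for every intended number `n` of users, the
view of the shuffler is `(ε, δ)`-differentially private whenever the number `m` of users who follow
the protocol is at least `γ n` (and at most `n`). -/
def Protocol.RobustlyShufflePrivate {X Y Ω O : Type*} [MeasurableSpace Y] [MeasurableSpace Ω]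
    [MeasurableSpace O] (S : Protocol X Y Ω O) (ε δ γ : ℝ) : Prop :=
  ∀ n m : ℕ, γ * n ≤ m → m ≤ n →
    DifferentiallyPrivate (fun x : Fin m → X => S.view n x) ε δ

/-! ### Sparse mean estimation -/

/-- The hypercube `{-1, +1}^d`. -/
abbrev Cube (d : ℕ) : Type := Fin d → ℤˣ

/-- The mean vector of a distribution on `{-1, +1}^d`. -/
def mean {d : ℕ} (P : PMF (Cube d)) (j : Fin d) : ℝ :=
  ∑ x : Cube d, (P x).toReal * ((x j : ℤ) : ℝ)

/-- The probability that the output of `M` lies in `E` when its input consists of `n` independent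
samples from `P`, over the randomness of both the samples and `M`. -/
def sampleProb {d n : ℕ} {O : Type*} [MeasurableSpace O] (M : (Fin n → Cube d) → Measure O)
    (P : PMF (Cube d)) (E : Set O) : ℝ≥0∞ :=
  ∑ x : Fin n → Cube d, (∏ i, P (x i)) * M x E

/-- `M` solves `(d, k, α)`-sparse mean estimation from `n` samples. -/
def SolvesSparseMean {d n : ℕ} (k : ℕ) (α : ℝ)
    (M : (Fin n → Cube d) → Measure (Fin d → Set.Icc (-1 : ℝ) 1)) : Prop :=
  ∀ P : PMF (Cube d), {j : Fin d | mean P j ≠ 0}.ncard ≤ k →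
    99 / 100 ≤ sampleProb M P {V | ∀ j, |mean P j - (V j : ℝ)| ≤ α}

end ShuffleModel

end

noncomputable section

namespace ShuffleModel

/-! ### A tracing inequality for differentially private mechanisms -/

/-! For each coordinate `j`, let the samples be uniform on the cube except for a mean `±β` in
coordinate `j`, where `β` is slightly larger than `α`. The sign of the `j`-th output entry must
reveal the sign of the bias, so the acceptance probabilities of the tests `V j > 0`, summed over
`j`, differ by at least `0.98 d` between the two signs (`mixed_sub_ge`).

Privacy bounds this gap from above. Tracing (`sum_correlation_le`): one private mechanism, run on a
uniform `x`, correlates with the coordinates of `x` by `O(ε√d)` in total over `j`, because for an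
independent `x` the correlation is centred and subgaussian of scale `√d`. The mechanism must be the
same for all `j`, while the other biased users depend on `j`. The shuffled view of more users is a
post-processing of the view of fewer (`lintegral_obs_cons`), so those users are absorbed into the
test, and robustness keeps the remaining view private as long as at least `n/3` users remain.
Replacing biased users one at a time then costs `O(β ε √d)` each (`sum_hybrid_le`), provided at
least `n/3` users keep uniform data.

When all users are biased, that many uniform users are created by writing bias `β` as the even
mixture of bias `0` and bias `2β` (`mixed_succ`). Of the two splits `(a, b)` and `(b, a)` into
uniform and biased users, at least one has `n/2` uniform users and a small gap; the other has gap at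
most `d`. Averaging gives `2 * gap ≤ d + 40 n β ε √d` (`sum_mixed_sub_le`). Since `0.98 > 1/2`, the
term `d` does not swallow the lower bound. -/

/-- The moment generating function of a Rademacher sum with coefficients in `[-1, 1]`. -/
theorem sum_cube_exp_le {d : ℕ} (a : Fin d → ℝ) (ha : ∀ j, |a j| ≤ 1) (t : ℝ) :
    ∑ x : Cube d, ((2 : ℝ) ^ d)⁻¹ * Real.exp (t * ∑ j, ((x j : ℤ) : ℝ) * a j)
      ≤ Real.exp (d * t ^ 2 / 2) := by
  have h1 : ∀ x : Cube d, ((2 : ℝ) ^ d)⁻¹ * Real.exp (t * ∑ j, ((x j : ℤ) : ℝ) * a j)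
      = ∏ j, ((1 / 2) * Real.exp (t * (((x j : ℤ) : ℝ) * a j))) := by
    intro x
    rw [Finset.prod_mul_distrib, ← Real.exp_sum, Finset.mul_sum]
    simp
  have h2 : ∀ j, ∑ e : ℤˣ, ((1 / 2) * Real.exp (t * (((e : ℤ) : ℝ) * a j)))
      ≤ Real.exp (t ^ 2 / 2) := by
    intro j
    have h : ∑ e : ℤˣ, ((1 / 2) * Real.exp (t * (((e : ℤ) : ℝ) * a j)))
        = Real.cosh (t * a j) := by
      rw [Real.cosh_eq]
      simp
      ring
    rw [h]
    refine (Real.cosh_le_exp_half_sq _).trans (Real.exp_le_exp.2 ?_)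
    have : a j ^ 2 ≤ 1 := by
      rw [sq_le_one_iff_abs_le_one]; exact ha j
    nlinarith [sq_nonneg t]
  calc _ = ∏ j, ∑ e : ℤˣ, ((1 / 2) * Real.exp (t * (((e : ℤ) : ℝ) * a j))) := by
        simp_rw [h1]
        rw [Finset.prod_univ_sum, Fintype.piFinset_univ]
    _ ≤ ∏ _j : Fin d, Real.exp (t ^ 2 / 2) :=
        Finset.prod_le_prod (fun j _ => Finset.sum_nonneg fun e _ => by positivity)
          fun j _ => h2 j
    _ = Real.exp (d * t ^ 2 / 2) := by
        rw [← Real.exp_sum]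
        simp
        ring

/-- The uniform distribution on the cube has mean zero. -/
theorem sum_cube_coord {d : ℕ} (j : Fin d) : ∑ x : Cube d, ((x j : ℤ) : ℝ) = 0 := by
  have h : ∑ x : Cube d, ((x j : ℤ) : ℝ) = ∑ x : Cube d, (((-x) j : ℤ) : ℝ) :=
    (Equiv.sum_comp (Equiv.neg (Cube d)) fun x : Cube d => ((x j : ℤ) : ℝ)).symm
  have h' : ∑ x : Cube d, (((-x) j : ℤ) : ℝ) = -∑ x : Cube d, ((x j : ℤ) : ℝ) := by
    rw [← Finset.sum_neg_distrib]
    simp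
  linarith

theorem sum_cube_const (d : ℕ) : ∑ _x : Cube d, ((2 : ℝ) ^ d)⁻¹ = 1 := by
  simp

/-- An approximate domination of measures on events extends to bounded functions. -/
theorem integral_le_of_measure_le {R : Type*} [MeasurableSpace R] {μ ν : Measure R}
    [IsProbabilityMeasure μ] [IsProbabilityMeasure ν] {ε δ : ℝ} (hδ : 0 ≤ δ)
    (h : ∀ C, MeasurableSet C → μ C ≤ ENNReal.ofReal (Real.exp ε) * ν C + ENNReal.ofReal δ)
    {f : R → ℝ} (hf : Measurable f) {K : ℝ} (h0 : ∀ s, 0 ≤ f s) (hK : ∀ s, f s ≤ K) :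
    ∫ s, f s ∂μ ≤ Real.exp ε * ∫ s, f s ∂ν + δ * K := by
  have hR : Nonempty R := by
    by_contra hR
    rw [not_nonempty_iff] at hR
    have := measure_univ (μ := μ)
    rw [Measure.eq_zero_of_isEmpty μ] at this
    simp at this
  have hK0 : 0 ≤ K := (h0 hR.some).trans (hK _)
  have hint : ∀ (ρ : Measure R) [IsProbabilityMeasure ρ], Integrable f ρ := fun ρ _ =>
    Integrable.of_bound hf.aestronglyMeasurable K
      (Filter.Eventually.of_forall fun s => by
        rw [Real.norm_eq_abs, abs_of_nonneg (h0 s)]; exact hK s)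
  have hreal : ∀ C, MeasurableSet C → μ.real C ≤ Real.exp ε * ν.real C + δ := by
    intro C hC
    have := ENNReal.toReal_mono (by finiteness) (h C hC)
    rwa [ENNReal.toReal_add (by finiteness) (by finiteness), ENNReal.toReal_mul,
      ENNReal.toReal_ofReal (Real.exp_pos _).le, ENNReal.toReal_ofReal hδ] at this
  -- Layer cake: integrating the event inequality over thresholds in `(0, K]` turns the additive `δ`
  -- into `δ * K`.
  have hcake : ∀ (ρ : Measure R) [IsProbabilityMeasure ρ],
      ∫ s, f s ∂ρ = ∫ t in Set.Ioc 0 K, ρ.real {a | t ≤ f a} := fun ρ _ =>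
    (hint ρ).integral_eq_integral_Ioc_meas_le (Filter.Eventually.of_forall h0)
      (Filter.Eventually.of_forall hK)
  have hmeas : ∀ (ρ : Measure R) [IsProbabilityMeasure ρ],
      IntegrableOn (fun t => ρ.real {a | t ≤ f a}) (Set.Ioc 0 K) := fun ρ _ => by
    have hanti : Antitone fun t => ρ.real {a | t ≤ f a} := fun s t hst =>
      measureReal_mono fun a (ha : t ≤ f a) => hst.trans ha
    exact ((hanti.antitoneOn _).integrableOn_isCompact isCompact_Icc).mono_set
      Set.Ioc_subset_Icc_self
  rw [hcake μ, hcake ν, ← integral_const_mul]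
  have hc : δ * K = ∫ _t in Set.Ioc 0 K, δ := by
    simp [hK0, mul_comm]
  rw [hc, ← integral_add ((hmeas ν).const_mul _) (integrable_const _)]
  refine setIntegral_mono (hmeas μ) (((hmeas ν).const_mul _).add (integrable_const _)) ?_
  intro t
  exact hreal _ (measurableSet_le measurable_const hf)


section Tracing

variable {d : ℕ} {R : Type*} [MeasurableSpace R] {M : Cube d → Measure R}
  [∀ x, IsProbabilityMeasure (M x)] {ε δ : ℝ}

/-- Under a private mechanism, the expectation of a bounded function of the input and the output is
at most `exp ε` times the one for an independent input, up to an additive error. -/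
theorem sum_integral_le_resample (hδ : 0 ≤ δ)
    (hM : ∀ x x' C, MeasurableSet C →
      M x C ≤ ENNReal.ofReal (Real.exp ε) * M x' C + ENNReal.ofReal δ)
    {ψ : Cube d → R → ℝ} (hψ : ∀ x, Measurable (ψ x)) {K : ℝ} (h0 : ∀ x s, 0 ≤ ψ x s)
    (hK : ∀ x s, ψ x s ≤ K) :
    ∑ x, ((2 : ℝ) ^ d)⁻¹ * ∫ s, ψ x s ∂M x ≤
        Real.exp ε * (∑ x, ((2 : ℝ) ^ d)⁻¹ * ∫ s, (∑ y, ((2 : ℝ) ^ d)⁻¹ * ψ y s) ∂M x) + δ * K ∧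
    ∑ x, ((2 : ℝ) ^ d)⁻¹ * ∫ s, (∑ y, ((2 : ℝ) ^ d)⁻¹ * ψ y s) ∂M x ≤
        Real.exp ε * (∑ x, ((2 : ℝ) ^ d)⁻¹ * ∫ s, ψ x s ∂M x) + δ * K := by
  set c : ℝ := ((2 : ℝ) ^ d)⁻¹ with hc
  have hc0 : 0 ≤ c := by positivity
  have hc1 : ∑ _x : Cube d, c = 1 := sum_cube_const d
  have hint : ∀ x y, Integrable (ψ y) (M x) := fun x y =>
    Integrable.of_bound (hψ y).aestronglyMeasurable K
      (Filter.Eventually.of_forall fun s => by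
        rw [Real.norm_eq_abs, abs_of_nonneg (h0 y s)]; exact hK y s)
  have hres : ∑ x, c * ∫ s, (∑ y, c * ψ y s) ∂M x
      = ∑ x, ∑ y, c * (c * ∫ s, ψ y s ∂M x) := by
    refine Finset.sum_congr rfl fun x _ => ?_
    rw [integral_finsetSum _ fun y _ => (hint x y).const_mul _, Finset.mul_sum]
    simp_rw [integral_const_mul]
  -- Both averages become averages over pairs `(x, y)`, so privacy can be applied to each pair
  -- separately.
  have hdup : ∑ y, c * ∫ s, ψ y s ∂M y = ∑ x : Cube d, ∑ y, c * (c * ∫ s, ψ y s ∂M y) := by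
    rw [Finset.sum_comm]
    refine Finset.sum_congr rfl fun y _ => ?_
    rw [← Finset.sum_mul, hc1, one_mul]
  have hconst : ∑ _x : Cube d, ∑ _y : Cube d, c * (c * (δ * K)) = δ * K := by
    have h : ∀ t : ℝ, ∑ _y : Cube d, c * t = t := fun t => by
      rw [← Finset.sum_mul, hc1, one_mul]
    rw [h, h]
  rw [hres, hdup]
  constructor
  · rw [← hconst, Finset.mul_sum, ← Finset.sum_add_distrib]
    refine Finset.sum_le_sum fun x _ => ?_
    rw [Finset.mul_sum, ← Finset.sum_add_distrib]
    refine Finset.sum_le_sum fun y _ => ?_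
    have := integral_le_of_measure_le hδ (hM y x) (hψ y) (h0 y) (hK y)
    calc _ ≤ c * (c * (Real.exp ε * ∫ s, ψ y s ∂M x + δ * K)) := by gcongr
      _ = _ := by ring
  · conv_rhs => rw [← hconst, Finset.mul_sum, ← Finset.sum_add_distrib]
    refine Finset.sum_le_sum fun x _ => ?_
    rw [Finset.mul_sum, ← Finset.sum_add_distrib]
    refine Finset.sum_le_sum fun y _ => ?_
    have := integral_le_of_measure_le hδ (hM x y) (hψ y) (h0 y) (hK y)
    calc _ ≤ c * (c * (Real.exp ε * ∫ s, ψ y s ∂M y + δ * K)) := by gcongr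
      _ = _ := by ring

/-- A differentially private mechanism applied to a uniformly random point `x` of the cube cannot
be well correlated with many coordinates of `x`. -/
theorem sum_correlation_le (hd : 1 ≤ d) (hε : 0 < ε) (hδ : 0 ≤ δ) (hδε : δ * d ≤ ε ^ 2)
    (hM : ∀ x x' C, MeasurableSet C →
      M x C ≤ ENNReal.ofReal (Real.exp ε) * M x' C + ENNReal.ofReal δ)
    {f : Fin d → R → ℝ} (hf : ∀ j, Measurable (f j)) (hf1 : ∀ j s, |f j s| ≤ 1) :
    ∑ j, ∑ x : Cube d, ((2 : ℝ) ^ d)⁻¹ * ((x j : ℤ) : ℝ) * ∫ s, f j s ∂M x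
      ≤ 10 * (ε * √d) := by
  set c : ℝ := ((2 : ℝ) ^ d)⁻¹ with hc
  have hc0 : 0 ≤ c := by positivity
  have hc1 : ∑ _x : Cube d, c = 1 := sum_cube_const d
  set r : ℝ := √d with hr
  have hr2 : r ^ 2 = d := Real.sq_sqrt (by positivity)
  have hr1 : 1 ≤ r := by rw [hr, Real.one_le_sqrt]; exact_mod_cast hd
  have hr0 : 0 < r := by linarith
  -- The tracing statistic. The sum to be bounded is its mean when `s` is drawn from `M x` for the
  -- same `x`.
  let Z : Cube d → R → ℝ := fun x s => ∑ j, ((x j : ℤ) : ℝ) * f j s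
  have hZm : ∀ x, Measurable (Z x) := fun x =>
    Finset.measurable_fun_sum _ fun j _ => (hf j).const_mul _
  have hcoord : ∀ (x : Cube d) j, |((x j : ℤ) : ℝ)| = 1 := fun x j => by
    rcases Int.units_eq_one_or (x j) with h | h <;> simp [h]
  have hZd : ∀ x s, |Z x s| ≤ d := fun x s => by
    calc |Z x s| ≤ ∑ j, |((x j : ℤ) : ℝ) * f j s| := Finset.abs_sum_le_sum_abs _ _
      _ ≤ ∑ _j : Fin d, (1 : ℝ) := Finset.sum_le_sum fun j _ => by
          rw [abs_mul, hcoord, one_mul]; exact hf1 j s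
      _ = d := by simp
  have hZint : ∀ x y, Integrable (Z x) (M y) := fun x y =>
    Integrable.of_bound (hZm x).aestronglyMeasurable d
      (Filter.Eventually.of_forall fun s => hZd x s)
  have hT : ∑ j, ∑ x : Cube d, c * ((x j : ℤ) : ℝ) * ∫ s, f j s ∂M x
      = ∑ x, c * ∫ s, Z x s ∂M x := by
    rw [Finset.sum_comm]
    refine Finset.sum_congr rfl fun x _ => ?_
    have hfi : ∀ j, Integrable (f j) (M x) := fun j =>
      Integrable.of_bound (hf j).aestronglyMeasurable 1
        (Filter.Eventually.of_forall fun s => hf1 j s)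
    rw [integral_finsetSum _ fun j _ => (hfi j).const_mul _, Finset.mul_sum]
    simp_rw [integral_const_mul, mul_assoc]
  have hmean : ∀ s, ∑ y, c * Z y s = 0 := fun s => by
    simp only [Z]
    rw [← Finset.mul_sum, Finset.sum_comm]
    simp_rw [← Finset.sum_mul, sum_cube_coord]
    simp
  -- At scale `1 / r` the subgaussian exponent is `1 / 2`, and `exp (1 / 2) ≤ 2`.
  have hmgf : ∀ s, ∑ y, c * Real.exp (Z y s / r) ≤ 2 := fun s => by
    have h := sum_cube_exp_le (fun j => f j s) (fun j => hf1 j s) r⁻¹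
    have h2 : (d : ℝ) * r⁻¹ ^ 2 / 2 = 1 / 2 := by rw [← hr2]; field_simp
    rw [h2] at h
    have h3 : Real.exp (1 / 2) ≤ 2 := by
      have h4 : Real.exp (1 / 2) ^ 2 ≤ 2 ^ 2 := by
        rw [← Real.exp_nat_mul]
        norm_num
        linarith [Real.exp_one_lt_d9]
      exact (pow_le_pow_iff_left₀ (Real.exp_pos _).le (by norm_num) two_ne_zero).1 h4
    refine le_trans (le_of_eq ?_) (h.trans h3)
    refine Finset.sum_congr rfl fun y _ => ?_
    simp only [Z]
    congr 2
    ring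
  have havg : ∀ (g : Cube d → R → ℝ) (B : ℝ), (∀ x s, 0 ≤ g x s) → (∀ s, ∑ y, c * g y s ≤ B) →
      ∑ x, c * ∫ s, (∑ y, c * g y s) ∂M x ≤ B := by
    intro g B hg0 hgB
    calc _ ≤ ∑ _x : Cube d, c * B := by
          refine Finset.sum_le_sum fun x _ => mul_le_mul_of_nonneg_left ?_ hc0
          calc _ ≤ ∫ _s, B ∂M x := by
                refine integral_mono_of_nonneg (Filter.Eventually.of_forall fun s =>
                  Finset.sum_nonneg fun y _ => mul_nonneg hc0 (hg0 y s))
                  (integrable_const _) (Filter.Eventually.of_forall hgB)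
            _ = B := by simp
      _ = B := by rw [← Finset.sum_mul, hc1, one_mul]
  rw [hT]
  -- For `ε ≥ √d` the trivial bound `Z ≤ d = r ^ 2` suffices.
  rcases le_or_gt r ε with h1 | h1
  · calc _ ≤ ∑ _x : Cube d, c * d := by
          refine Finset.sum_le_sum fun x _ => mul_le_mul_of_nonneg_left ?_ hc0
          calc _ ≤ ∫ _s, (d : ℝ) ∂M x := integral_mono (hZint x x) (integrable_const _)
                fun s => (le_abs_self _).trans (hZd x s)
            _ = d := by simp
      _ = d := by rw [← Finset.sum_mul, hc1, one_mul]
      _ ≤ 10 * (ε * r) := by rw [← hr2]; nlinarith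
  have hδr : δ * d ≤ ε * r := by nlinarith
  rcases le_or_gt 1 ε with h2 | h2
  -- Large `ε`: the truncation level `r * ε` makes the independent tail of order `r * exp (-ε)`,
  -- which cancels the privacy factor `exp ε`.
  · let ψ : Cube d → R → ℝ := fun x s => max (Z x s - r * ε) 0
    have hψm : ∀ x, Measurable (ψ x) := fun x => ((hZm x).sub_const _).max measurable_const
    have hψ0 : ∀ x s, 0 ≤ ψ x s := fun x s => le_max_right _ _
    have hψd : ∀ x s, ψ x s ≤ d := fun x s =>
      max_le (by nlinarith [(le_abs_self _).trans (hZd x s)]) (by positivity)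
    have hψi : ∀ x, Integrable (ψ x) (M x) := fun x =>
      Integrable.of_bound (hψm x).aestronglyMeasurable d
        (Filter.Eventually.of_forall fun s => by
          rw [Real.norm_eq_abs, abs_of_nonneg (hψ0 x s)]; exact hψd x s)
    have hψe : ∀ x s, ψ x s ≤ r * Real.exp (-ε) * Real.exp (Z x s / r) := fun x s => by
      rw [mul_assoc, ← Real.exp_add]
      refine max_le ?_ (by positivity)
      have := Real.add_one_le_exp (-ε + Z x s / r)
      calc Z x s - r * ε = r * (-ε + Z x s / r) := by field_simp; ring
        _ ≤ _ := by gcongr; linarith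
    have hA := havg ψ (r * Real.exp (-ε) * 2) hψ0 fun s => by
      calc _ ≤ ∑ y, c * (r * Real.exp (-ε) * Real.exp (Z y s / r)) := by
            gcongr with y; exact hψe y s
        _ = r * Real.exp (-ε) * ∑ y, c * Real.exp (Z y s / r) := by
            rw [Finset.mul_sum]; exact Finset.sum_congr rfl fun y _ => by ring
        _ ≤ _ := by gcongr; exact hmgf s
    have hB := (sum_integral_le_resample hδ hM hψm hψ0 hψd).1
    calc ∑ x, c * ∫ s, Z x s ∂M x ≤ ∑ x, (c * (r * ε) + c * ∫ s, ψ x s ∂M x) := by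
          refine Finset.sum_le_sum fun x _ => ?_
          rw [← mul_add]
          refine mul_le_mul_of_nonneg_left ?_ hc0
          calc _ ≤ ∫ s, (r * ε + ψ x s) ∂M x :=
                integral_mono (hZint x x) ((integrable_const _).add (hψi x)) fun s => by
                  have := le_max_left (Z x s - r * ε) 0
                  simp only [ψ]; linarith
            _ = _ := by rw [integral_add (integrable_const _) (hψi x)]; simp
      _ = r * ε + ∑ x, c * ∫ s, ψ x s ∂M x := by
          rw [Finset.sum_add_distrib, ← Finset.sum_mul, hc1, one_mul]
      _ ≤ r * ε + (Real.exp ε * (r * Real.exp (-ε) * 2) + δ * d) := by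
          gcongr
          exact hB.trans (by gcongr)
      _ = r * ε + (r * 2 * (Real.exp ε * Real.exp (-ε)) + δ * d) := by ring
      _ = r * ε + (r * 2 + δ * d) := by rw [← Real.exp_add]; simp
      _ ≤ 10 * (ε * r) := by nlinarith
  -- Small `ε`: privacy is used in opposite directions for the positive and negative parts, so that
  -- only the factor `exp ε - 1 = O(ε)` survives.
  · let p : Cube d → R → ℝ := fun x s => max (Z x s) 0
    let q : Cube d → R → ℝ := fun x s => max (-Z x s) 0
    have hpm : ∀ x, Measurable (p x) := fun x => (hZm x).max measurable_const
    have hqm : ∀ x, Measurable (q x) := fun x => (hZm x).neg.max measurable_const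
    have hp0 : ∀ x s, 0 ≤ p x s := fun x s => le_max_right _ _
    have hq0 : ∀ x s, 0 ≤ q x s := fun x s => le_max_right _ _
    have hpd : ∀ x s, p x s ≤ d := fun x s =>
      max_le ((le_abs_self _).trans (hZd x s)) (by positivity)
    have hqd : ∀ x s, q x s ≤ d := fun x s =>
      max_le ((neg_le_abs _).trans (hZd x s)) (by positivity)
    have hpq : ∀ x s, Z x s = p x s - q x s := fun x s => by
      simp only [p, q]
      rcases le_total 0 (Z x s) with h | h
      · rw [max_eq_left h, max_eq_right (by linarith)]; ring
      · rw [max_eq_right h, max_eq_left (by linarith)]; ring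
    have hpi : ∀ x, Integrable (p x) (M x) := fun x =>
      Integrable.of_bound (hpm x).aestronglyMeasurable d
        (Filter.Eventually.of_forall fun s => by
          rw [Real.norm_eq_abs, abs_of_nonneg (hp0 x s)]; exact hpd x s)
    have hqi : ∀ x, Integrable (q x) (M x) := fun x =>
      Integrable.of_bound (hqm x).aestronglyMeasurable d
        (Filter.Eventually.of_forall fun s => by
          rw [Real.norm_eq_abs, abs_of_nonneg (hq0 x s)]; exact hqd x s)
    -- Since `Z` is centred for an independent input, both parts have the same resampled mean,
    -- called `A` below.
    have hsum : ∀ s, ∑ y, c * q y s = ∑ y, c * p y s := fun s => by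
      have := hmean s
      simp_rw [hpq, mul_sub, Finset.sum_sub_distrib] at this
      linarith
    have hA := havg p (r * 2) hp0 fun s => by
      calc _ ≤ ∑ y, c * (r * Real.exp (Z y s / r)) := by
            refine Finset.sum_le_sum fun y _ => mul_le_mul_of_nonneg_left ?_ hc0
            refine max_le ?_ (by positivity)
            have := Real.add_one_le_exp (Z y s / r)
            calc Z y s = r * (Z y s / r) := by field_simp
              _ ≤ _ := by gcongr; linarith
        _ = r * ∑ y, c * Real.exp (Z y s / r) := by
            rw [Finset.mul_sum]; exact Finset.sum_congr rfl fun y _ => by ring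
        _ ≤ _ := by gcongr; exact hmgf s
    have hP := (sum_integral_le_resample hδ hM hpm hp0 hpd).1
    have hQ := (sum_integral_le_resample hδ hM hqm hq0 hqd).2
    simp_rw [← hc, hsum] at hQ
    rw [← hc] at hP
    have hZpq : ∑ x, c * ∫ s, Z x s ∂M x
        = ∑ x, c * ∫ s, p x s ∂M x - ∑ x, c * ∫ s, q x s ∂M x := by
      rw [← Finset.sum_sub_distrib]
      refine Finset.sum_congr rfl fun x _ => ?_
      rw [← mul_sub, ← integral_sub (hpi x) (hqi x)]
      simp_rw [hpq]
    have hA0 : 0 ≤ ∑ x, c * ∫ s, (∑ y, c * p y s) ∂M x :=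
      Finset.sum_nonneg fun x _ => mul_nonneg hc0 <| integral_nonneg fun s =>
        Finset.sum_nonneg fun y _ => mul_nonneg hc0 (hp0 y s)
    have hq_nonneg : 0 ≤ ∑ x, c * ∫ s, q x s ∂M x :=
      Finset.sum_nonneg fun x _ => mul_nonneg hc0 <| integral_nonneg fun s => hq0 x s
    rw [hZpq]
    set A := ∑ x, c * ∫ s, (∑ y, c * p y s) ∂M x
    set q' := ∑ x, c * ∫ s, q x s ∂M x
    have hexp : Real.exp ε ≤ 1 + 2 * ε := by
      have := Real.abs_exp_sub_one_le (x := ε) (by rw [abs_of_pos hε]; exact h2.le)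
      rw [abs_of_pos hε] at this
      linarith [(abs_le.1 this).2]
    by_cases hqA : q' ≤ A
    · have : Real.exp ε * q' ≤ q' + 2 * ε * A := by nlinarith
      nlinarith
    · nlinarith

end Tracing

/-! ### The shuffler forgets the order of messages -/

section Shuffler

variable {Y : Type*} [MeasurableSpace Y]

/-- A bijection matching equal entries of `l` and `l'` reindexes the sum over permutations by left
multiplication. -/
theorem shuffleLaw_perm {l l' : List Y} (h : l.Perm l') : shuffleLaw l = shuffleLaw l' := by
  classical
  obtain ⟨k, w, rfl⟩ : ∃ k, ∃ w : Fin k → Y, l = List.ofFn w := ⟨l.length, l.get, by simp⟩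
  obtain ⟨k', w', rfl⟩ : ∃ k, ∃ w : Fin k → Y, l' = List.ofFn w := ⟨l'.length, l'.get, by simp⟩
  obtain rfl : k = k' := by simpa using h.length_eq
  let e : Fin k ≃ Fin k := (finCongr List.length_ofFn.symm).trans
    ((Equiv.ofBijective h.idxBij ⟨h.idxBij_injective, h.idxBij_surjective⟩).trans
      (finCongr List.length_ofFn))
  have he : ∀ i, w' (e i) = w i := fun i => by
    have := h.getElem_idxBij_eq_getElem (Fin.cast List.length_ofFn.symm i)
    rw [List.getElem_ofFn, List.getElem_ofFn] at this
    exact this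
  rw [shuffleLaw_ofFn, shuffleLaw_ofFn]
  congr 1
  exact Fintype.sum_equiv (Equiv.mulLeft e) _ _ fun σ => by simp [he]

/-- An order-blind function is constant on the support of the shuffle, so a shuffle followed by
another shuffle can be dropped. -/
theorem lintegral_shuffleLaw {F : List Y → ℝ≥0∞} (hF : Measurable F)
    (hperm : ∀ l l' : List Y, l.Perm l' → F l = F l') (l : List Y) :
    ∫⁻ l', F l' ∂shuffleLaw l = F l := by
  have h : ∀ σ : Equiv.Perm (Fin l.length), F (List.ofFn fun i => l.get (σ i)) = F l := fun σ =>
    hperm _ _ <| by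
      conv_rhs => rw [← List.ofFn_get l]
      exact Equiv.Perm.ofFn_comp_perm σ l.get
  rw [shuffleLaw, lintegral_smul_measure, lintegral_finsetSum_measure]
  simp_rw [lintegral_dirac' _ hF, h]
  simp only [Finset.sum_const, Finset.card_univ, Fintype.card_perm, Fintype.card_fin,
    nsmul_eq_mul, smul_eq_mul]
  rw [← mul_assoc, ENNReal.inv_mul_cancel (by exact_mod_cast Nat.factorial_ne_zero _) (by simp),
    one_mul]

theorem _root_.Measurable.list_append {Z : Type*} [MeasurableSpace Z] {f g : Z → List Y}
    (hf : Measurable f) (hg : Measurable g) : Measurable fun z => f z ++ g z :=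
  Measurable.comp (g := fun p : List Y × List Y => p.1 ++ p.2) measurable_append (hf.prodMk hg)

end Shuffler

/-! ### Adding users as post-processing of the shuffled view -/

namespace Protocol

variable {X Y Ω O : Type*} [MeasurableSpace Y] [MeasurableSpace Ω] [MeasurableSpace O]

/-- The view of the shuffler when the users hold the data in the list `xs`. -/
def obs (S : Protocol X Y Ω O) (n : ℕ) (xs : List X) : Measure (Ω × List Y) :=
  S.publicCoins ⊗ₘ (shuffler Y ∘ₖ S.messages n xs)

instance (S : Protocol X Y Ω O) (n : ℕ) (xs : List X) : IsProbabilityMeasure (S.obs n xs) := by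
  unfold obs; infer_instance

theorem view_eq_obs (S : Protocol X Y Ω O) (n : ℕ) {m : ℕ} (x : Fin m → X) :
    S.view n x = S.obs n (List.ofFn x) := rfl

theorem lintegral_obs (S : Protocol X Y Ω O) (n : ℕ) (xs : List X) {g : Ω × List Y → ℝ≥0∞}
    (hg : Measurable g) :
    ∫⁻ s, g s ∂S.obs n xs
      = ∫⁻ ω, ∫⁻ l, ∫⁻ l', g (ω, l') ∂shuffler Y l ∂S.messages n xs ω ∂S.publicCoins := by
  rw [obs, Measure.lintegral_compProd hg]
  refine lintegral_congr fun ω => ?_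
  exact Kernel.lintegral_comp _ _ _ (hg.comp measurable_prodMk_left)

/-- The test on the view with one more user `y` given by adding the messages of `y`, shuffling, and
applying the test `g`. -/
def addUser (S : Protocol X Y Ω O) (n : ℕ) (y : X) (g : Ω × List Y → ℝ≥0∞) (s : Ω × List Y) :
    ℝ≥0∞ :=
  ∫⁻ b, ∫⁻ l', g (s.1, l') ∂shuffler Y (b ++ s.2) ∂S.randomizer n y s.1

theorem measurable_shuffle_append {g : Ω × List Y → ℝ≥0∞} (hg : Measurable g) :
    Measurable fun p : (Ω × List Y) × List Y =>
      ∫⁻ l', g (p.1.1, l') ∂shuffler Y (p.2 ++ p.1.2) := by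
  have hg' : Measurable fun q : (Ω × List Y) × List Y => g (q.1.1, q.2) :=
    hg.comp ((measurable_fst.comp measurable_fst).prodMk measurable_snd)
  have h1 : Measurable fun q : Ω × List Y => ∫⁻ l', g (q.1, l') ∂shuffler Y q.2 :=
    Measurable.lintegral_kernel_prod_right'
      (κ := (shuffler Y).comap (Prod.snd : Ω × List Y → List Y) measurable_snd) hg'
  have h2 : Measurable fun p : (Ω × List Y) × List Y => (p.1.1, p.2 ++ p.1.2) :=
    (measurable_fst.comp measurable_fst).prodMk
      (measurable_snd.list_append (measurable_snd.comp measurable_fst))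
  simpa only [Function.comp_def] using h1.comp h2

theorem measurable_addUser (S : Protocol X Y Ω O) (n : ℕ) (y : X) {g : Ω × List Y → ℝ≥0∞}
    (hg : Measurable g) : Measurable (S.addUser n y g) :=
  Measurable.lintegral_kernel_prod_right'
    (κ := (S.randomizer n y).comap (Prod.fst : Ω × List Y → Ω) measurable_fst)
    (measurable_shuffle_append hg)

theorem addUser_le_one (S : Protocol X Y Ω O) (n : ℕ) (y : X) {g : Ω × List Y → ℝ≥0∞}
    (hg : ∀ s, g s ≤ 1) (s : Ω × List Y) : S.addUser n y g s ≤ 1 := by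
  unfold addUser
  calc _ ≤ ∫⁻ b, ∫⁻ _l', 1 ∂shuffler Y (b ++ s.2) ∂S.randomizer n y s.1 :=
        lintegral_mono fun b => lintegral_mono fun l' => hg _
    _ = 1 := by simp

theorem addUser_perm (S : Protocol X Y Ω O) (n : ℕ) (y : X) (g : Ω × List Y → ℝ≥0∞) (ω : Ω)
    {l l' : List Y} (h : l.Perm l') : S.addUser n y g (ω, l) = S.addUser n y g (ω, l') := by
  unfold addUser
  refine lintegral_congr fun b => ?_
  change ∫⁻ l', g (ω, l') ∂shuffleLaw (b ++ l) = ∫⁻ l', g (ω, l') ∂shuffleLaw (b ++ _)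
  rw [shuffleLaw_perm (h.append_left b)]

theorem lintegral_addUser_shuffler (S : Protocol X Y Ω O) (n : ℕ) (y : X)
    {g : Ω × List Y → ℝ≥0∞} (hg : Measurable g) (ω : Ω) (l : List Y) :
    ∫⁻ l', S.addUser n y g (ω, l') ∂shuffler Y l = S.addUser n y g (ω, l) :=
  lintegral_shuffleLaw ((S.measurable_addUser n y hg).comp measurable_prodMk_left)
    (fun _ _ h => S.addUser_perm n y g ω h) l

/-- The view with one more user is a post-processing of the view without this user. -/
theorem lintegral_obs_cons (S : Protocol X Y Ω O) (n : ℕ) (y : X) (xs : List X)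
    {g : Ω × List Y → ℝ≥0∞} (hg : Measurable g) :
    ∫⁻ s, g s ∂S.obs n (y :: xs) = ∫⁻ s, S.addUser n y g s ∂S.obs n xs := by
  rw [lintegral_obs _ _ _ hg, lintegral_obs _ _ _ (S.measurable_addUser n y hg)]
  refine lintegral_congr fun ω => ?_
  -- `addUser` reshuffles, so the shuffle of the smaller view is redundant.
  simp_rw [S.lintegral_addUser_shuffler n y hg]
  have hm : Measurable fun p : List Y × List Y => ∫⁻ l', g (ω, l') ∂shuffler Y (p.1 ++ p.2) := by
    have h2 : Measurable fun p : List Y × List Y => ((ω, p.2), p.1) :=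
      (measurable_const.prodMk measurable_snd).prodMk measurable_fst
    simpa only [Function.comp_def] using (measurable_shuffle_append hg).comp h2
  have hm' : Measurable fun l : List Y => ∫⁻ l', g (ω, l') ∂shuffler Y l :=
    (hg.comp measurable_prodMk_left).lintegral_kernel
  rw [messages, Kernel.lintegral_map _ measurable_append _ hm', Kernel.prod_apply,
    lintegral_prod_symm _ hm.aemeasurable]
  rfl

/-- Given the public string, the two users' private coins are independent, so Tonelli applies, and
the shuffler ignores whose messages come first. -/
theorem addUser_comm (S : Protocol X Y Ω O) (n : ℕ) (y z : X) {g : Ω × List Y → ℝ≥0∞}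
    (hg : Measurable g) : S.addUser n y (S.addUser n z g) = S.addUser n z (S.addUser n y g) := by
  have key : ∀ (y z : X) (ω : Ω) (l : List Y), S.addUser n y (S.addUser n z g) (ω, l)
      = ∫⁻ b, ∫⁻ c, ∫⁻ l', g (ω, l') ∂shuffler Y (c ++ (b ++ l)) ∂S.randomizer n z ω
          ∂S.randomizer n y ω := by
    intro y z ω l
    conv_lhs => rw [addUser]
    refine lintegral_congr fun b => ?_
    exact S.lintegral_addUser_shuffler n z hg ω (b ++ l)
  funext ⟨ω, l⟩
  rw [key, key, lintegral_lintegral_swap]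
  · refine lintegral_congr fun b => lintegral_congr fun c => ?_
    have hp : (b ++ (c ++ l)).Perm (c ++ (b ++ l)) := by
      rw [← List.append_assoc, ← List.append_assoc]
      exact List.perm_append_comm.append_right l
    change ∫⁻ l', g (ω, l') ∂shuffleLaw _ = ∫⁻ l', g (ω, l') ∂shuffleLaw _
    rw [shuffleLaw_perm hp]
  · have h := measurable_shuffle_append hg
    have h2 : Measurable fun p : List Y × List Y => ((ω, p.1 ++ l), p.2) :=
      (measurable_const.prodMk (measurable_fst.list_append measurable_const)).prodMk measurable_snd
    simpa only [Function.comp_def, Function.uncurry_def] using (h.comp h2).aemeasurable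

/-- The view does not depend on the order of the users. -/
theorem lintegral_obs_perm (S : Protocol X Y Ω O) (n : ℕ) {xs ys : List X} (h : xs.Perm ys)
    {g : Ω × List Y → ℝ≥0∞} (hg : Measurable g) :
    ∫⁻ s, g s ∂S.obs n xs = ∫⁻ s, g s ∂S.obs n ys := by
  induction h generalizing g with
  | nil => rfl
  | cons x _ ih =>
    rw [lintegral_obs_cons _ _ _ _ hg, lintegral_obs_cons _ _ _ _ hg,
      ih (S.measurable_addUser n x hg)]
  | swap x y l =>
    rw [lintegral_obs_cons _ _ _ _ hg, lintegral_obs_cons _ _ _ _ hg,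
      lintegral_obs_cons _ _ _ _ (S.measurable_addUser n _ hg),
      lintegral_obs_cons _ _ _ _ (S.measurable_addUser n _ hg), S.addUser_comm n _ _ hg]
  | trans _ _ ih1 ih2 => rw [ih1 hg, ih2 hg]

end Protocol

/-! ### Expectations over independent samples -/

section Expect

variable {X : Type*} [Fintype X]

/-- The sum of `G` over all lists of data, weighted by a product of weights. -/
def expect : List (X → ℝ) → (List X → ℝ) → ℝ
  | [], G => G []
  | w :: ws, G => ∑ x, w x * expect ws fun l => G (x :: l)

/-- No positivity or normalization is asked of the weights: the hybrid argument uses the signed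
weight `x j / 2 ^ d`. -/
theorem expect_perm {ws ws' : List (X → ℝ)} (h : ws.Perm ws') {G : List X → ℝ}
    (hG : ∀ l l', l.Perm l' → G l = G l') : expect ws G = expect ws' G := by
  induction h generalizing G with
  | nil => rfl
  | cons w _ ih =>
    simp only [expect]
    exact Finset.sum_congr rfl fun x _ => by rw [ih fun l l' h => hG _ _ (h.cons x)]
  | swap w w' ws =>
    simp only [expect, Finset.mul_sum]
    rw [Finset.sum_comm]
    refine Finset.sum_congr rfl fun x _ => Finset.sum_congr rfl fun y _ => ?_
    rw [mul_left_comm]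
    congr 3
    funext l
    exact hG _ _ (List.Perm.swap _ _ _)
  | trans _ _ ih1 ih2 => rw [ih1 hG, ih2 hG]

theorem expect_append (ws vs : List (X → ℝ)) (G : List X → ℝ) :
    expect (ws ++ vs) G = expect ws fun l => expect vs fun l' => G (l ++ l') := by
  induction ws generalizing G with
  | nil => rfl
  | cons w ws ih =>
    simp only [List.cons_append, expect]
    exact Finset.sum_congr rfl fun x _ => by rw [ih]

theorem expect_sum {ι : Type*} (s : Finset ι) (ws : List (X → ℝ)) (G : ι → List X → ℝ) :
    expect ws (fun l => ∑ i ∈ s, G i l) = ∑ i ∈ s, expect ws (G i) := by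
  induction ws generalizing G with
  | nil => rfl
  | cons w ws ih =>
    simp only [expect]
    rw [Finset.sum_comm]
    exact Finset.sum_congr rfl fun x _ => by rw [ih, Finset.mul_sum]

theorem expect_const_mul (c : ℝ) (ws : List (X → ℝ)) (G : List X → ℝ) :
    expect ws (fun l => c * G l) = c * expect ws G := by
  induction ws generalizing G with
  | nil => rfl
  | cons w ws ih =>
    simp only [expect, Finset.mul_sum]
    exact Finset.sum_congr rfl fun x _ => by rw [ih]; ring

theorem expect_le {ws : List (X → ℝ)} (hws : ∀ w ∈ ws, (∀ x, 0 ≤ w x) ∧ ∑ x, w x = 1)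
    {G : List X → ℝ} {c : ℝ} (hG : ∀ l : List X, l.length = ws.length → G l ≤ c) :
    expect ws G ≤ c := by
  induction ws generalizing G with
  | nil => exact hG _ rfl
  | cons w ws ih =>
    obtain ⟨h0, h1⟩ := hws w (by simp)
    calc expect (w :: ws) G ≤ ∑ x, w x * c := by
          refine Finset.sum_le_sum fun x _ => mul_le_mul_of_nonneg_left ?_ (h0 x)
          exact ih (fun w' hw' => hws w' (by simp [hw'])) fun l hl => hG _ (by simp [hl])
      _ = c := by rw [← Finset.sum_mul, h1, one_mul]

theorem expect_nonneg {ws : List (X → ℝ)} (hws : ∀ w ∈ ws, (∀ x, 0 ≤ w x) ∧ ∑ x, w x = 1)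
    {G : List X → ℝ} (hG : ∀ l, 0 ≤ G l) : 0 ≤ expect ws G := by
  have h := expect_le hws (G := fun l => (-1) * G l) (c := 0) fun l _ => by linarith [hG l]
  rw [expect_const_mul] at h
  linarith

theorem sum_prod_mul_eq_expect (n : ℕ) (w : X → ℝ) (G : List X → ℝ) :
    ∑ x : Fin n → X, (∏ i, w (x i)) * G (List.ofFn x) = expect (List.replicate n w) G := by
  induction n generalizing G with
  | zero => simp [expect]
  | succ n ih =>
    rw [List.replicate_succ, expect, ← Equiv.sum_comp (Fin.consEquiv fun _ => X),
      Fintype.sum_prod_type]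
    refine Finset.sum_congr rfl fun x _ => ?_
    rw [← ih, Finset.mul_sum]
    refine Finset.sum_congr rfl fun y _ => ?_
    simp [Fin.consEquiv, Fin.prod_univ_succ, List.ofFn_succ, mul_assoc]

end Expect

/-! ### Acceptance probabilities of tests on the view -/

namespace Protocol

variable {X Y Ω O : Type*} [MeasurableSpace Y] [MeasurableSpace Ω] [MeasurableSpace O]

/-- The probability that the test `g` accepts the view of users holding the data in `xs`. -/
def accept (S : Protocol X Y Ω O) (n : ℕ) (g : Ω × List Y → ℝ≥0∞) (xs : List X) : ℝ :=
  (∫⁻ s, g s ∂S.obs n xs).toReal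

theorem lintegral_obs_le_one (S : Protocol X Y Ω O) (n : ℕ) {g : Ω × List Y → ℝ≥0∞}
    (hg1 : ∀ s, g s ≤ 1) (xs : List X) : ∫⁻ s, g s ∂S.obs n xs ≤ 1 :=
  (lintegral_mono hg1).trans (by simp)

theorem accept_nonneg (S : Protocol X Y Ω O) (n : ℕ) (g : Ω × List Y → ℝ≥0∞) (xs : List X) :
    0 ≤ S.accept n g xs := ENNReal.toReal_nonneg

theorem accept_le_one (S : Protocol X Y Ω O) (n : ℕ) {g : Ω × List Y → ℝ≥0∞}
    (hg1 : ∀ s, g s ≤ 1) (xs : List X) : S.accept n g xs ≤ 1 :=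
  ENNReal.toReal_le_of_le_ofReal zero_le_one (by simpa using S.lintegral_obs_le_one n hg1 xs)

theorem accept_perm (S : Protocol X Y Ω O) (n : ℕ) {g : Ω × List Y → ℝ≥0∞} (hg : Measurable g)
    {xs ys : List X} (h : xs.Perm ys) : S.accept n g xs = S.accept n g ys := by
  rw [accept, accept, S.lintegral_obs_perm n h hg]

theorem accept_eq_integral (S : Protocol X Y Ω O) (n : ℕ) {g : Ω × List Y → ℝ≥0∞}
    (hg : Measurable g) (hg1 : ∀ s, g s ≤ 1) (xs : List X) :
    S.accept n g xs = ∫ s, (g s).toReal ∂S.obs n xs :=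
  (integral_toReal hg.aemeasurable
    (Filter.Eventually.of_forall fun s => (hg1 s).trans_lt ENNReal.one_lt_top)).symm

/-- Additional users with independent data amount to a post-processing of the view. -/
theorem exists_accept_eq_expect [Fintype X] (S : Protocol X Y Ω O) (n : ℕ) {ws : List (X → ℝ)}
    (hws : ∀ w ∈ ws, (∀ x, 0 ≤ w x) ∧ ∑ x, w x = 1) {g : Ω × List Y → ℝ≥0∞} (hg : Measurable g)
    (hg1 : ∀ s, g s ≤ 1) :
    ∃ g' : Ω × List Y → ℝ≥0∞, Measurable g' ∧ (∀ s, g' s ≤ 1) ∧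
      ∀ xs, expect ws (fun ys => S.accept n g (ys ++ xs)) = S.accept n g' xs := by
  induction ws generalizing g with
  | nil => exact ⟨g, hg, hg1, fun xs => rfl⟩
  | cons w ws ih =>
    obtain ⟨h0, h1⟩ := hws w (by simp)
    choose g' hg' hg1' hacc using fun x => ih (fun w' hw' => hws w' (by simp [hw']))
      (S.measurable_addUser n x hg) (S.addUser_le_one n x hg1)
    -- The new test averages, over the datum `x` of the added user, the tests obtained by induction.
    refine ⟨fun s => ∑ x, ENNReal.ofReal (w x) * g' x s,
      Finset.measurable_fun_sum _ fun x _ => (hg' x).const_mul _, fun s => ?_, fun xs => ?_⟩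
    · calc _ ≤ ∑ x, ENNReal.ofReal (w x) := Finset.sum_le_sum fun x _ =>
            mul_le_of_le_one_right' (hg1' x s)
        _ = 1 := by rw [← ENNReal.ofReal_sum_of_nonneg fun x _ => h0 x, h1, ENNReal.ofReal_one]
    · rw [expect]
      conv_rhs => rw [accept, lintegral_finsetSum _ fun x _ => (hg' x).const_mul _]
      rw [ENNReal.toReal_sum fun x _ => by
        rw [lintegral_const_mul _ (hg' x)]
        exact ENNReal.mul_ne_top ENNReal.ofReal_ne_top
          ((S.lintegral_obs_le_one n (hg1' x) xs).trans_lt ENNReal.one_lt_top).ne]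
      refine Finset.sum_congr rfl fun x _ => ?_
      rw [lintegral_const_mul _ (hg' x), ENNReal.toReal_mul, ENNReal.toReal_ofReal (h0 x)]
      congr 1
      rw [← accept, ← hacc]
      congr 1
      funext ys
      rw [accept, accept, List.cons_append, S.lintegral_obs_cons n x _ hg]

end Protocol

/-! ### The hard distributions -/

section CubeWeight

variable {d : ℕ}

/-- The density of the distribution on the cube whose coordinates are independent, the `j`-th with
mean `β` and the others with mean zero. -/
def cubeWeight (j : Fin d) (β : ℝ) (x : Cube d) : ℝ :=
  ((2 : ℝ) ^ d)⁻¹ + β * (((2 : ℝ) ^ d)⁻¹ * ((x j : ℤ) : ℝ))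

/-- The density of the uniform distribution on the cube. -/
def uniformWeight (d : ℕ) (_ : Cube d) : ℝ := ((2 : ℝ) ^ d)⁻¹

theorem uniformWeight_isWeight :
    (∀ x, 0 ≤ uniformWeight d x) ∧ ∑ x, uniformWeight d x = 1 :=
  ⟨fun _ => by unfold uniformWeight; positivity, sum_cube_const d⟩

theorem cubeWeight_isWeight (j : Fin d) {β : ℝ} (hβ : |β| ≤ 1) :
    (∀ x, 0 ≤ cubeWeight j β x) ∧ ∑ x, cubeWeight j β x = 1 := by
  constructor
  · intro x
    have h : cubeWeight j β x = ((2 : ℝ) ^ d)⁻¹ * (1 + β * ((x j : ℤ) : ℝ)) := by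
      unfold cubeWeight; ring
    rw [h]
    obtain ⟨h1, h2⟩ := abs_le.1 hβ
    refine mul_nonneg (by positivity) ?_
    rcases Int.units_eq_one_or (x j) with h | h <;> simp [h] <;> linarith
  · simp only [cubeWeight]
    rw [Finset.sum_add_distrib, sum_cube_const, ← Finset.mul_sum, ← Finset.mul_sum, sum_cube_coord]
    simp

/-- Flipping coordinate `i` is a bijection of the cube that negates every summand. -/
theorem sum_cube_coord_mul_coord (i j : Fin d) (hij : i ≠ j) :
    ∑ x : Cube d, ((x j : ℤ) : ℝ) * ((x i : ℤ) : ℝ) = 0 := by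
  have h := Equiv.sum_comp (Equiv.mulLeft (Pi.mulSingle i (-1) : Cube d))
    fun x : Cube d => ((x j : ℤ) : ℝ) * ((x i : ℤ) : ℝ)
  simp [Pi.mulSingle_eq_of_ne hij.symm] at h
  linarith

theorem sum_cubeWeight_mul_coord (j : Fin d) (β : ℝ) (i : Fin d) :
    ∑ x, cubeWeight j β x * ((x i : ℤ) : ℝ) = if i = j then β else 0 := by
  have h : ∀ x : Cube d, cubeWeight j β x * ((x i : ℤ) : ℝ) = ((2 : ℝ) ^ d)⁻¹ * ((x i : ℤ) : ℝ)
      + β * ((2 : ℝ) ^ d)⁻¹ * (((x j : ℤ) : ℝ) * ((x i : ℤ) : ℝ)) := fun x => by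
    unfold cubeWeight; ring
  simp_rw [h]
  rw [Finset.sum_add_distrib, ← Finset.mul_sum, ← Finset.mul_sum, sum_cube_coord]
  split_ifs with hij
  · subst hij
    have h1 : ∀ x : Cube d, ((x i : ℤ) : ℝ) * ((x i : ℤ) : ℝ) = 1 := fun x => by
      rcases Int.units_eq_one_or (x i) with h | h <;> simp [h]
    simp [h1]
  · rw [sum_cube_coord_mul_coord i j hij]; simp

/-- The distribution on the cube whose coordinates are independent, the `j`-th with mean `β` and
the others with mean zero. -/
def biasedCube (j : Fin d) (β : ℝ) (hβ : |β| ≤ 1) : PMF (Cube d) :=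
  PMF.ofFintype (fun x => ENNReal.ofReal (cubeWeight j β x)) <| by
    obtain ⟨h0, h1⟩ := cubeWeight_isWeight j hβ
    rw [← ENNReal.ofReal_sum_of_nonneg fun x _ => h0 x, h1, ENNReal.ofReal_one]

theorem biasedCube_toReal (j : Fin d) (β : ℝ) (hβ : |β| ≤ 1) (x : Cube d) :
    (biasedCube j β hβ x).toReal = cubeWeight j β x := by
  rw [biasedCube, PMF.ofFintype_apply, ENNReal.toReal_ofReal ((cubeWeight_isWeight j hβ).1 x)]

theorem mean_biasedCube (j : Fin d) (β : ℝ) (hβ : |β| ≤ 1) (i : Fin d) :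
    mean (biasedCube j β hβ) i = if i = j then β else 0 := by
  simp only [mean, biasedCube_toReal]
  exact sum_cubeWeight_mul_coord j β i

theorem ncard_mean_biasedCube_le (j : Fin d) (β : ℝ) (hβ : |β| ≤ 1) :
    {i | mean (biasedCube j β hβ) i ≠ 0}.ncard ≤ 1 := by
  have h : {i | mean (biasedCube j β hβ) i ≠ 0} ⊆ {j} := fun i hi => by
    by_contra hij
    exact hi ((mean_biasedCube j β hβ i).trans (if_neg hij))
  simpa using Set.ncard_le_ncard h

end CubeWeight

/-! ### Sampling probabilities -/

section SampleProb

variable {d n : ℕ} {O : Type*} [MeasurableSpace O]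

theorem sampleProb_mono (M : (Fin n → Cube d) → Measure O) (P : PMF (Cube d)) {E F : Set O}
    (h : E ⊆ F) : sampleProb M P E ≤ sampleProb M P F := by
  unfold sampleProb
  gcongr

theorem sampleProb_univ (M : (Fin n → Cube d) → Measure O) [∀ x, IsProbabilityMeasure (M x)]
    (P : PMF (Cube d)) : sampleProb M P Set.univ = 1 := by
  unfold sampleProb
  simp only [measure_univ, mul_one]
  have h : ∑ x : Cube d, P x = 1 := (tsum_fintype (L := .unconditional _) _).symm.trans P.tsum_coe
  rw [← Fintype.piFinset_univ, ← Finset.prod_univ_sum, Finset.prod_const, h, one_pow]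

theorem sampleProb_add_le_one (M : (Fin n → Cube d) → Measure O)
    [∀ x, IsProbabilityMeasure (M x)] (P : PMF (Cube d)) {E F : Set O} (hE : MeasurableSet E)
    (h : Disjoint E F) : sampleProb M P E + sampleProb M P F ≤ 1 := by
  rw [← sampleProb_univ M P]
  unfold sampleProb
  rw [← Finset.sum_add_distrib]
  refine Finset.sum_le_sum fun x _ => ?_
  rw [← mul_add, ← measure_union' h hE]
  gcongr
  exact Set.subset_univ _

end SampleProb

/-! ### The hybrid argument -/

namespace Protocol

variable {d : ℕ} {Y Ω O : Type*} [MeasurableSpace Y] [MeasurableSpace Ω] [MeasurableSpace O]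
  {S : Protocol (Cube d) Y Ω O} {n : ℕ} {ε δ : ℝ}

theorem RobustlyShufflePrivate.obs_cons_le (hS : S.RobustlyShufflePrivate ε δ (1 / 3))
    {w : List (Cube d)} (h3 : n ≤ 3 * (w.length + 1)) (hn : w.length + 1 ≤ n) (x x' : Cube d)
    (C : Set (Ω × List Y)) (hC : MeasurableSet C) :
    S.obs n (x :: w) C ≤ ENNReal.ofReal (Real.exp ε) * S.obs n (x' :: w) C + ENNReal.ofReal δ := by
  have hr : (1 / 3 : ℝ) * n ≤ ((w.length + 1 : ℕ) : ℝ) := by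
    have : (n : ℝ) ≤ 3 * ((w.length + 1 : ℕ) : ℝ) := by exact_mod_cast h3
    linarith
  have h := hS n (w.length + 1) hr hn (Fin.cons x w.get) (Fin.cons x' w.get)
    ⟨0, fun j hj => by
      obtain ⟨k, rfl⟩ := Fin.exists_succ_eq.2 hj
      simp⟩ C hC
  have hl : ∀ y : Cube d, List.ofFn (Fin.cons y w.get : Fin (w.length + 1) → Cube d) = y :: w :=
    fun y => by rw [List.ofFn_cons, List.ofFn_get]
  simpa only [view_eq_obs, hl] using h

variable {g : Fin d → Ω × List Y → ℝ≥0∞}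

/-- One user with a biased datum among sufficiently many users with uniform data is hard to
detect, whatever the other users do. -/
theorem RobustlyShufflePrivate.sum_expect_le (hS : S.RobustlyShufflePrivate ε δ (1 / 3))
    (hd : 1 ≤ d) (hε : 0 < ε) (hδ : 0 ≤ δ) (hδε : δ * d ≤ ε ^ 2)
    (hg : ∀ j, Measurable (g j)) (hg1 : ∀ j s, g j s ≤ 1) {a b : ℕ} (h3 : n ≤ 3 * (a + 1))
    (hn : a + 1 ≤ n) {Q : Fin d → Cube d → ℝ}
    (hQ : ∀ j, (∀ x, 0 ≤ Q j x) ∧ ∑ x, Q j x = 1) :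
    ∑ j, expect ((fun x => ((2 : ℝ) ^ d)⁻¹ * ((x j : ℤ) : ℝ)) ::
        (List.replicate a (uniformWeight d) ++ List.replicate b (Q j))) (S.accept n (g j))
      ≤ 10 * (ε * √d) := by
  -- The `b` users with data from `Q j` move into the test; what remains, `x ↦ S.obs n (x :: w)`,
  -- does not depend on `j`.
  choose g' hg' hg1' hacc using fun j => S.exists_accept_eq_expect n
    (ws := List.replicate b (Q j)) (fun w hw => by rw [List.eq_of_mem_replicate hw]; exact hQ j)
    (hg j) (hg1 j)
  have h1 : ∀ j, expect ((fun x => ((2 : ℝ) ^ d)⁻¹ * ((x j : ℤ) : ℝ)) ::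
        (List.replicate a (uniformWeight d) ++ List.replicate b (Q j))) (S.accept n (g j))
      = expect (List.replicate a (uniformWeight d)) fun w =>
          ∑ x, ((2 : ℝ) ^ d)⁻¹ * ((x j : ℤ) : ℝ) * S.accept n (g' j) (x :: w) := by
    intro j
    rw [expect, expect_sum]
    refine Finset.sum_congr rfl fun x _ => ?_
    rw [expect_const_mul, expect_append]
    congr 2
    funext w
    rw [← hacc j]
    congr 1
    funext ys
    exact S.accept_perm n (hg j) (List.perm_append_comm (l₁ := x :: w) (l₂ := ys))
  simp_rw [h1]
  rw [← expect_sum]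
  -- Tracing applies for every fixed data `w` of the uniform users. Only `a + 1 ≥ n / 3` users are
  -- present, which is where robustness enters.
  refine expect_le (fun w hw => by
    rw [List.eq_of_mem_replicate hw]; exact uniformWeight_isWeight) fun w hw => ?_
  rw [List.length_replicate] at hw
  subst hw
  simp_rw [fun j x => S.accept_eq_integral n (hg' j) (hg1' j) x]
  refine sum_correlation_le hd hε hδ hδε (hS.obs_cons_le h3 hn)
    (fun j => (hg' j).ennreal_toReal) fun j s => ?_
  rw [abs_of_nonneg ENNReal.toReal_nonneg]
  exact ENNReal.toReal_le_of_le_ofReal zero_le_one (by simpa using hg1' j s)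

/-- The density is affine in `β`; the linear part is the signed weight handled by tracing. -/
theorem expect_cubeWeight_cons (j : Fin d) (β : ℝ) (ws : List (Cube d → ℝ))
    (G : List (Cube d) → ℝ) :
    expect (cubeWeight j β :: ws) G = expect (uniformWeight d :: ws) G
      + β * expect ((fun x => ((2 : ℝ) ^ d)⁻¹ * ((x j : ℤ) : ℝ)) :: ws) G := by
  simp only [expect, cubeWeight, uniformWeight]
  rw [Finset.mul_sum, ← Finset.sum_add_distrib]
  exact Finset.sum_congr rfl fun x _ => by ring

theorem perm_replicate_succ {α : Type*} (a b : ℕ) (u q : α) :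
    (List.replicate a u ++ List.replicate (b + 1) q).Perm
      (q :: (List.replicate a u ++ List.replicate b q)) := by
  rw [List.replicate_succ]
  exact List.perm_middle

/-- Replacing uniform by biased data of part of the users is hard to detect. -/
theorem RobustlyShufflePrivate.sum_hybrid_le (hS : S.RobustlyShufflePrivate ε δ (1 / 3))
    (hd : 1 ≤ d) (hε : 0 < ε) (hδ : 0 ≤ δ) (hδε : δ * d ≤ ε ^ 2)
    (hg : ∀ j, Measurable (g j)) (hg1 : ∀ j s, g j s ≤ 1) {t σ : ℝ} (ht : 0 ≤ t) (ht1 : t ≤ 1)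
    (hσ : σ = 1 ∨ σ = -1) {a b : ℕ} (h3 : n ≤ 3 * a) (hn : a + b = n) :
    ∑ j, σ * (expect (List.replicate a (uniformWeight d) ++
          List.replicate b (cubeWeight j (σ * t))) (S.accept n (g j))
        - expect (List.replicate n (uniformWeight d)) (S.accept n (g j)))
      ≤ b * (t * (10 * (ε * √d))) := by
  induction b generalizing a with
  | zero =>
    obtain rfl : a = n := hn
    simp
  | succ b ih =>
    have hσt : |σ * t| ≤ 1 := by
      rcases hσ with rfl | rfl <;> simpa [abs_of_nonneg ht] using ht1
    have hσσ : σ * (σ * t) = t := by rcases hσ with rfl | rfl <;> ring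
    -- One biased user becomes uniform, which preserves `n ≤ 3 * a`.
    have h1 := ih (a := a + 1) (by omega) (by omega)
    have h2 := hS.sum_expect_le hd hε hδ hδε hg hg1 (n := n) (a := a) (b := b) (by omega)
      (by omega) (Q := fun j => cubeWeight j (σ * t)) fun j => cubeWeight_isWeight j hσt
    have h3 : ∀ j, expect (List.replicate a (uniformWeight d) ++
          List.replicate (b + 1) (cubeWeight j (σ * t))) (S.accept n (g j))
        = expect (List.replicate (a + 1) (uniformWeight d) ++
          List.replicate b (cubeWeight j (σ * t))) (S.accept n (g j))
        + σ * t * expect ((fun x => ((2 : ℝ) ^ d)⁻¹ * ((x j : ℤ) : ℝ)) ::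
          (List.replicate a (uniformWeight d) ++ List.replicate b (cubeWeight j (σ * t))))
            (S.accept n (g j)) := fun j => by
      rw [expect_perm (perm_replicate_succ a b _ _) fun l l' h => S.accept_perm n (hg j) h,
        expect_cubeWeight_cons]
      rfl
    simp_rw [h3]
    calc _ = ∑ j, σ * (expect (List.replicate (a + 1) (uniformWeight d) ++
          List.replicate b (cubeWeight j (σ * t))) (S.accept n (g j))
        - expect (List.replicate n (uniformWeight d)) (S.accept n (g j)))
        + t * ∑ j, expect ((fun x => ((2 : ℝ) ^ d)⁻¹ * ((x j : ℤ) : ℝ)) ::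
          (List.replicate a (uniformWeight d) ++ List.replicate b (cubeWeight j (σ * t))))
            (S.accept n (g j)) := by
          rw [Finset.mul_sum, ← Finset.sum_add_distrib]
          have key : ∀ A B C : ℝ, σ * (A + σ * t * B - C) = σ * (A - C) + t * B :=
            fun A B C => by linear_combination B * hσσ
          exact Finset.sum_congr rfl fun j _ => key _ _ _
      _ ≤ b * (t * (10 * (ε * √d))) + t * (10 * (ε * √d)) := by gcongr
      _ = _ := by push_cast; ring

/-- The acceptance probability when `c` users have data of mean `β` in coordinate `j`, `a` users
have uniform data and `b` users have data of mean `2 * β` in coordinate `j`. -/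
def mixed (S : Protocol (Cube d) Y Ω O) (n : ℕ) (g : Ω × List Y → ℝ≥0∞) (j : Fin d) (β : ℝ)
    (a b c : ℕ) : ℝ :=
  expect (List.replicate c (cubeWeight j β) ++ (List.replicate a (uniformWeight d) ++
    List.replicate b (cubeWeight j (2 * β)))) (S.accept n g)

/-- The density with mean `β` is the average of the uniform one and the one with mean `2 * β`. -/
theorem mixed_succ {g : Ω × List Y → ℝ≥0∞} (hg : Measurable g) (j : Fin d) (β : ℝ) (a b c : ℕ) :
    S.mixed n g j β a b (c + 1)
      = (S.mixed n g j β (a + 1) b c + S.mixed n g j β a (b + 1) c) / 2 := by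
  have hperm : ∀ l l' : List (Cube d), l.Perm l' → S.accept n g l = S.accept n g l' :=
    fun l l' h => S.accept_perm n hg h
  have h1 : S.mixed n g j β (a + 1) b c = expect (uniformWeight d ::
      (List.replicate c (cubeWeight j β) ++ (List.replicate a (uniformWeight d) ++
        List.replicate b (cubeWeight j (2 * β))))) (S.accept n g) :=
    expect_perm List.perm_middle hperm
  have h2 : S.mixed n g j β a (b + 1) c = expect (cubeWeight j (2 * β) ::
      (List.replicate c (cubeWeight j β) ++ (List.replicate a (uniformWeight d) ++
        List.replicate b (cubeWeight j (2 * β))))) (S.accept n g) :=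
    expect_perm (((perm_replicate_succ a b _ _).append_left _).trans List.perm_middle) hperm
  rw [h1, h2, mixed, List.replicate_succ, List.cons_append, expect_cubeWeight_cons,
    expect_cubeWeight_cons j (2 * β)]
  ring

theorem mixed_mem_Icc {g : Ω × List Y → ℝ≥0∞} (hg1 : ∀ s, g s ≤ 1) (j : Fin d) {β : ℝ}
    (hβ : |2 * β| ≤ 1) (a b c : ℕ) : S.mixed n g j β a b c ∈ Set.Icc 0 1 := by
  have hβ' : |β| ≤ 1 := by
    rw [abs_mul, abs_two] at hβ
    linarith [abs_nonneg β]
  have hws : ∀ w ∈ List.replicate c (cubeWeight j β) ++ (List.replicate a (uniformWeight d) ++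
      List.replicate b (cubeWeight j (2 * β))), (∀ x, 0 ≤ w x) ∧ ∑ x, w x = 1 := by
    intro w hw
    rw [List.mem_append, List.mem_append] at hw
    rcases hw with hw | hw | hw <;> rw [List.eq_of_mem_replicate hw]
    · exact cubeWeight_isWeight j hβ'
    · exact uniformWeight_isWeight
    · exact cubeWeight_isWeight j hβ
  exact ⟨expect_nonneg hws fun l => S.accept_nonneg n g l,
    expect_le hws fun l _ => S.accept_le_one n hg1 l⟩

/-- Tests on the view of a robustly private protocol do not tell positive from negative bias in a
random coordinate. -/
theorem RobustlyShufflePrivate.sum_mixed_sub_le (hS : S.RobustlyShufflePrivate ε δ (1 / 3))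
    (hd : 1 ≤ d) (hε : 0 < ε) (hδ : 0 ≤ δ) (hδε : δ * d ≤ ε ^ 2)
    (hg : ∀ j, Measurable (g j)) (hg1 : ∀ j s, g j s ≤ 1) {β : ℝ} (hβ : 0 ≤ β)
    (hβ1 : 2 * β ≤ 1) {a b c : ℕ} (hn : a + b + c = n) :
    ∑ j, (S.mixed n (g j) j β a b c - S.mixed n (g j) j (-β) a b c)
      + ∑ j, (S.mixed n (g j) j β b a c - S.mixed n (g j) j (-β) b a c)
      ≤ d + n * (40 * β * (ε * √d)) := by
  have habs : ∀ σ : ℝ, σ = 1 ∨ σ = -1 → |2 * (σ * β)| ≤ 1 := by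
    rintro σ (rfl | rfl) <;> simpa [abs_of_nonneg hβ] using hβ1
  induction c generalizing a b with
  | zero =>
    -- Both signs are compared with all-uniform data; each comparison costs `b * 2β * 10 ε √d`.
    have small : ∀ a b : ℕ, a + b = n → n ≤ 3 * a →
        ∑ j, (S.mixed n (g j) j β a b 0 - S.mixed n (g j) j (-β) a b 0)
          ≤ n * (40 * β * (ε * √d)) := by
      intro a b hab h3
      have h1 := hS.sum_hybrid_le hd hε hδ hδε hg hg1 (t := 2 * β) (σ := 1) (by linarith) hβ1
        (Or.inl rfl) h3 hab
      have h2 := hS.sum_hybrid_le hd hε hδ hδε hg hg1 (t := 2 * β) (σ := -1) (by linarith) hβ1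
        (Or.inr rfl) h3 hab
      have hbn : (b : ℝ) ≤ n := by exact_mod_cast (by omega : b ≤ n)
      rw [one_mul] at h1
      rw [neg_one_mul, ← mul_neg] at h2
      calc _ ≤ b * (2 * β * (10 * (ε * √d))) + b * (2 * β * (10 * (ε * √d))) := by
            refine le_trans (le_of_eq ?_) (add_le_add h1 h2)
            rw [← Finset.sum_add_distrib]
            refine Finset.sum_congr rfl fun j _ => ?_
            simp only [mixed, List.replicate_zero, List.nil_append]
            ring
        _ = b * (40 * β * (ε * √d)) := by ring
        _ ≤ _ := by gcongr
    have large : ∀ a b : ℕ, ∑ j, (S.mixed n (g j) j β a b 0 - S.mixed n (g j) j (-β) a b 0)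
        ≤ d := by
      intro a b
      calc _ ≤ ∑ _j : Fin d, (1 : ℝ) := Finset.sum_le_sum fun j _ => by
            have h1 := (mixed_mem_Icc (S := S) (n := n) (hg1 j) j (β := β)
              (by simpa using habs 1 (Or.inl rfl)) a b 0).2
            have h2 := (mixed_mem_Icc (S := S) (n := n) (hg1 j) j (β := -β)
              (by simpa using habs (-1) (Or.inr rfl)) a b 0).1
            linarith
        _ = d := by simp
    -- The larger of `a` and `b` is at least `n / 2`, hence at least `n / 3`.
    rcases le_total b a with h | h
    · linarith [small a b (by omega) (by omega), large b a]
    · linarith [small b a (by omega) (by omega), large a b]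
  | succ c ih =>
    have h1 := ih (a := a + 1) (b := b) (by omega)
    have h2 := ih (a := a) (b := b + 1) (by omega)
    -- Expanding one user in both `(a, b)` and `(b, a)` gives four terms, which regroup into two
    -- swapped pairs; the claim is the mean of `h1` and `h2`.
    simp_rw [fun j β a b => mixed_succ (S := S) (n := n) (hg j) j β a b c]
    simp only [Finset.sum_sub_distrib, ← Finset.sum_div, Finset.sum_add_distrib] at h1 h2 ⊢
    linarith

end Protocol

/-! ### Reduction from sparse mean estimation -/

section Reduction

variable {d : ℕ} {Y Ω : Type*} [MeasurableSpace Y] [MeasurableSpace Ω]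

/-- The probability that the analyzer outputs a vector whose `j`-th entry is positive. -/
def positiveTest (S : Protocol (Cube d) Y Ω (Fin d → Set.Icc (-1 : ℝ) 1)) (n : ℕ) (j : Fin d)
    (s : Ω × List Y) : ℝ≥0∞ :=
  S.analyzer n s {V | 0 < (V j : ℝ)}

theorem measurableSet_positive (j : Fin d) :
    MeasurableSet {V : Fin d → Set.Icc (-1 : ℝ) 1 | 0 < (V j : ℝ)} :=
  measurableSet_lt measurable_const (measurable_subtype_coe.comp (measurable_pi_apply j))

theorem measurable_positiveTest (S : Protocol (Cube d) Y Ω (Fin d → Set.Icc (-1 : ℝ) 1)) (n : ℕ)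
    (j : Fin d) : Measurable (positiveTest S n j) :=
  (S.analyzer n).measurable_coe (measurableSet_positive j)

theorem positiveTest_le_one (S : Protocol (Cube d) Y Ω (Fin d → Set.Icc (-1 : ℝ) 1)) (n : ℕ)
    (j : Fin d) (s : Ω × List Y) : positiveTest S n j s ≤ 1 := prob_le_one

theorem sampleProb_exec_positive (S : Protocol (Cube d) Y Ω (Fin d → Set.Icc (-1 : ℝ) 1)) (n : ℕ)
    (j : Fin d) {β : ℝ} (hβ : |β| ≤ 1) :
    (sampleProb (fun x : Fin n → Cube d => S.exec x) (biasedCube j β hβ)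
        {V | 0 < (V j : ℝ)}).toReal
      = S.mixed n (positiveTest S n j) j β 0 0 n := by
  have hfin : ∀ x : Fin n → Cube d, (∏ i, biasedCube j β hβ (x i)) *
      S.exec x {V | 0 < (V j : ℝ)} ≠ ∞ := fun x =>
    ENNReal.mul_ne_top (ENNReal.prod_ne_top fun i _ => PMF.apply_ne_top _ _) (measure_ne_top _ _)
  rw [sampleProb, ENNReal.toReal_sum fun x _ => hfin x, Protocol.mixed, List.replicate_zero,
    List.replicate_zero, List.append_nil, List.append_nil, ← sum_prod_mul_eq_expect]
  refine Finset.sum_congr rfl fun x _ => ?_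
  rw [ENNReal.toReal_mul, ENNReal.toReal_prod]
  simp_rw [biasedCube_toReal]
  rw [Protocol.exec, Measure.bind_apply (measurableSet_positive j) (Kernel.aemeasurable _)]
  rfl

/-- As `α < β`, an `α`-accurate output has the sign of the bias in entry `j`, so the test accepts
with probability at least `0.99` for `β` and at most `0.01` for `-β`. -/
theorem mixed_sub_ge {S : Protocol (Cube d) Y Ω (Fin d → Set.Icc (-1 : ℝ) 1)} {n : ℕ} {α β : ℝ}
    (hS : SolvesSparseMean 1 α fun x : Fin n → Cube d => S.exec x) (hαβ : α < β) (hβ : |β| ≤ 1)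
    (j : Fin d) :
    98 / 100 ≤ S.mixed n (positiveTest S n j) j β 0 0 n
      - S.mixed n (positiveTest S n j) j (-β) 0 0 n := by
  have hβ' : |-β| ≤ 1 := by rwa [abs_neg]
  rw [← sampleProb_exec_positive S n j hβ, ← sampleProb_exec_positive S n j hβ']
  set M := fun x : Fin n → Cube d => S.exec x
  have hM : ∀ x, IsProbabilityMeasure (M x) := fun x => by
    simp only [M]; infer_instance
  have hpos : 99 / 100 ≤ sampleProb M (biasedCube j β hβ) {V | 0 < (V j : ℝ)} := by
    refine (hS _ (ncard_mean_biasedCube_le j β hβ)).trans (sampleProb_mono _ _ fun V hV => ?_)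
    have h := (abs_le.1 (hV j)).2
    rw [mean_biasedCube, if_pos rfl] at h
    simp only [Set.mem_ofPred_eq]
    linarith
  have hneg : sampleProb M (biasedCube j (-β) hβ') {V | 0 < (V j : ℝ)} + 99 / 100 ≤ 1 := by
    refine le_trans (add_le_add_right (hS _ (ncard_mean_biasedCube_le j (-β) hβ')) _)
      (sampleProb_add_le_one M _ (measurableSet_positive j) ?_)
    rw [Set.disjoint_left]
    intro V hV0 hV
    have h := (abs_le.1 (hV j)).1
    rw [mean_biasedCube, if_pos rfl] at h
    simp only [Set.mem_ofPred_eq] at hV0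
    linarith
  have htop : sampleProb M (biasedCube j β hβ) {V | 0 < (V j : ℝ)} ≠ ∞ :=
    ((sampleProb_mono _ _ (Set.subset_univ _)).trans_eq (sampleProb_univ M _)
      |>.trans_lt ENNReal.one_lt_top).ne
  have h1 := ENNReal.toReal_mono htop hpos
  have h2 := ENNReal.toReal_mono ENNReal.one_ne_top hneg
  rw [ENNReal.toReal_add (ne_top_of_le_ne_top ENNReal.one_ne_top (le_self_add.trans hneg))
    (by finiteness)] at h2
  have h3 : (99 / 100 : ℝ≥0∞).toReal = 99 / 100 := by simp
  rw [h3] at h1 h2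
  rw [ENNReal.toReal_one] at h2
  linarith

end Reduction

/-! ### Choice of parameters and conclusion -/

/-- The logarithm enters only through `log (d / δ) ≥ log 2 ≥ 1 / 2`; tracing needs no more than `δ *
d ≤ ε ^ 2`. -/
theorem delta_mul_le {d : ℕ} {α ε δ : ℝ} (hd : 2 ≤ d) (hα : 0 < α) (hα2 : α < 1 / 2)
    (hδ : 0 ≤ δ) (hδ1 : δ ≤ 1)
    (h : δ * Real.log (d / δ) ≤ 1 * (α ^ 2 * ε ^ 2 / d)) : δ * d ≤ ε ^ 2 := by
  have hd2 : (2 : ℝ) ≤ d := by exact_mod_cast hd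
  rcases hδ.eq_or_lt with rfl | hδ0
  · simpa using sq_nonneg ε
  have hlog : 1 / 2 ≤ Real.log (d / δ) := by
    have h1 : Real.log 2 ≤ Real.log (d / δ) :=
      Real.log_le_log two_pos (by rw [le_div_iff₀ hδ0]; nlinarith)
    linarith [Real.log_two_gt_d9]
  have h2 : δ * (1 / 2) ≤ α ^ 2 * ε ^ 2 / d := by
    rw [one_mul] at h
    exact (mul_le_mul_of_nonneg_left hlog hδ).trans h
  rw [le_div_iff₀ (by linarith)] at h2
  have h3 : α ^ 2 ≤ 1 / 2 := by nlinarith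
  nlinarith [mul_le_mul_of_nonneg_right h3 (sq_nonneg ε)]

end ShuffleModel

end

theorem mainTheorem12 :
    ∃ c₀ > (0 : ℝ), ∃ c₁ > (0 : ℝ),
      ∀ (d : ℕ) (α ε δ : ℝ), 2 ≤ d → 0 < α → α < 1 / 2 → 0 < ε → 0 ≤ δ → δ ≤ 1 →
        δ * Real.log (d / δ) ≤ c₀ * (α ^ 2 * ε ^ 2 / d) →
        ∀ (Y : Type u) (Ω : Type v) [MeasurableSpace Y] [MeasurableSpace Ω]
          (S : ShuffleModel.Protocol (ShuffleModel.Cube d) Y Ω (Fin d → Set.Icc (-1 : ℝ) 1)),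
          S.RobustlyShufflePrivate ε δ (1 / 3) →
          ∀ n : ℕ,
            ShuffleModel.SolvesSparseMean 1 α
              (fun x : Fin n → ShuffleModel.Cube d => S.exec x) →
            c₁ * (Real.sqrt d / (α * ε)) ≤ n := by
  -- The argument yields the constant `0.96 / 80 = 0.012`, which is at least `1 / 100`.
  refine ⟨1, one_pos, 1 / 100, by norm_num, ?_⟩
  intro d α ε δ hd hα hα2 hε hδ hδ1 hδlog Y Ω _ _ S hpriv n hsolve
  have hδε := ShuffleModel.delta_mul_le hd hα hα2 hδ hδ1 hδlog
  -- Needed are `α < β` for the sign test, `2 * β ≤ 1` for the doubled bias to be a mean, and `β ≤ 2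
  -- * α` for the final rate.
  set β : ℝ := min (2 * α) (1 / 2) with hβ
  have hβα : α < β := lt_min (by linarith) hα2
  have hβ0 : 0 < β := hα.trans hβα
  have hβ1 : β ≤ 1 / 2 := min_le_right _ _
  have hβ2 : β ≤ 2 * α := min_le_left _ _
  have hlow : (98 / 100 : ℝ) * d ≤
      ∑ j, (S.mixed n (ShuffleModel.positiveTest S n j) j β 0 0 n
        - S.mixed n (ShuffleModel.positiveTest S n j) j (-β) 0 0 n) := by
    calc (98 / 100 : ℝ) * d = ∑ _j : Fin d, (98 / 100 : ℝ) := by simp [mul_comm]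
      _ ≤ _ := Finset.sum_le_sum fun j _ => ShuffleModel.mixed_sub_ge hsolve hβα
          (by rw [abs_of_pos hβ0]; linarith) j
  -- With `a = b = 0` the two sums coincide, so this bounds twice the gap.
  have hupp := hpriv.sum_mixed_sub_le (n := n) (by omega) hε hδ hδε
    (ShuffleModel.measurable_positiveTest S n) (ShuffleModel.positiveTest_le_one S n) hβ0.le
    (by linarith) (a := 0) (b := 0) (c := n) (by omega)
  have hd0 : (0 : ℝ) < d := by exact_mod_cast (by omega : 0 < d)
  have hr : 0 < √(d : ℝ) := Real.sqrt_pos.2 hd0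
  have hr2 : √(d : ℝ) * √d = d := Real.mul_self_sqrt hd0.le
  have hmain : (96 / 100 : ℝ) * (√d * √d) ≤ n * (80 * α * ε) * √d := by
    rw [hr2]
    have h1 : (n : ℝ) * (40 * β * (ε * √d)) ≤ n * (40 * (2 * α) * (ε * √d)) := by gcongr
    linarith
  have hmain' : (96 / 100 : ℝ) * √d ≤ n * (80 * α * ε) := by
    rw [← mul_assoc] at hmain
    exact le_of_mul_le_mul_right hmain hr
  rw [← mul_div_assoc, div_le_iff₀ (by positivity)]
  linarith
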